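/- Let $\mathcal{A}$ be a complex Banach algebra with identity $1$, and write $\sigma(b)$ for the spectrum of $b\in\mathcal{A}$. Call $b\in\mathcal{A}$ quasinilpotent if $\sigma(b)=\{0\}$. Call $b\in\mathcal{A}$ generalized Drazin invertible if there is $x\in\mathcal{A}$ with $bx=xb$, $xbx=x$ and $b-b^2x$ quasinilpotent, and let $$\sigma_d(b)=\{\lambda\in\mathbb{C} : b-\lambda 1 \text{ is not generalized Drazin invertible}\}$$ be the generalized Drazin spectrum of $b$. Let $\mathcal{A}^{acc}$ be the set of all $b\in\mathcal{A}$ such that $b-\lambda 1$ is generalized Drazin invertible for every $\lambda\in\mathbb{C}\setminus\{0\}$. Call $b\in\mathcal{A}$ ag-Drazin invertible if there is $x\in\mathcal{A}$ with $bx=xb$, $xbx=x$ and $b-b^2x\in\mathcal{A}^{acc}$, and let $$\sigma_{ad}(b)=\{\lambda\in\mathbb{C} : b-\lambda 1 \text{ is not ag-Drazin invertible}\}$$ be the ag-Drazin spectrum of $b$. For $M\subseteq\mathbb{C}$ let $\mathrm{acc}\,M$ denote the set of accumulation points of $M$ in $\mathbb{C}$. Then for every $a\in\mathcal{A}$: 1.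 $a$ is ag-Drazin invertible if and only if $0\notin\mathrm{acc}\,\sigma_d(a)$; 2. $\sigma_{ad}(a)=\mathrm{acc}\,\sigma_d(a)$. -/

import Mathlib

namespace AGDrazin

variable {A : Type*} [NormedRing A] [NormedAlgebra ℂ A]

/-- `a` is quasinilpotent: its spectrum is `{0}`. -/
def IsQuasinilpotent (a : A) : Prop :=
  spectrum ℂ a = {0}

/-- `a` is generalized Drazin invertible: some `x` commuting with `a` satisfies `x a x = x`
and `a - a² x` is quasinilpotent. -/
def IsGDrazinInvertible (a : A) : Prop :=
  ∃ x : A, Commute a x ∧ x * a * x = x ∧ IsQuasinilpotent (a - a ^ 2 * x)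

/-- The generalized Drazin spectrum `σ_d(a)`. -/
def gDrazinSpectrum (a : A) : Set ℂ :=
  {μ : ℂ | ¬ IsGDrazinInvertible (a - μ • (1 : A))}

/-- Membership in `A^acc`: `a - μ 1` is generalized Drazin invertible for all `μ ≠ 0`. -/
def MemAcc (a : A) : Prop :=
  ∀ μ : ℂ, μ ≠ 0 → IsGDrazinInvertible (a - μ • (1 : A))

/-- `a` is ag-Drazin invertible: some `x` commuting with `a` satisfies `x a x = x`
and `a - a² x` lies in `A^acc`. -/
def IsAGDrazinInvertible (a : A) : Prop :=
  ∃ x : A, Commute a x ∧ x * a * x = x ∧ MemAcc (a - a ^ 2 * x)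

/-- The ag-Drazin spectrum `σ_ad(a)`. -/
def agDrazinSpectrum (a : A) : Set ℂ :=
  {μ : ℂ | ¬ IsAGDrazinInvertible (a - μ • (1 : A))}

end AGDrazin

namespace AGDrazin

open Filter Topology

/-! If a circle around 0 misses the spectrum of `a`, a Riesz idempotent `p` splits `a`: the spectrum
of `a * p` lies inside the circle, and `a` is invertible on the range of `1 - p`. Contour integrals
are avoided: on the unit circle, the mean of `(1 - z a)⁻¹` over the `2 ^ k`-th roots of unity is `(1
- a ^ (2 ^ k))⁻¹`, and `p` is the limit of these. In a nontrivial algebra, such splittings on small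
circles give Koliha's criterion (`isGDrazinInvertible_iff`), so `σ_d` is the derived set of the
spectrum. If 0 is not in `acc σ_d`, small circles missing the spectrum still exist, though spectral
points may cluster at 0, and the same splitting works. Conversely, near 0 the spectrum of `a` lies
in that of `a - a² x`. Translation gives part 2. -/

theorem commute_ringInverse {R : Type*} [Ring R] {a b : R} (h : Commute a b) :
    Commute a (Ring.inverse b) := by
  by_cases hb : IsUnit b
  · obtain ⟨u, rfl⟩ := hb
    rw [Ring.inverse_unit]
    exact h.units_inv_right
  · rw [Ring.inverse_non_unit _ hb]
    exact Commute.zero_right a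

theorem ringInverse_one_sub_mul_self {R : Type*} [Ring R] {w : R} (h₁ : IsUnit (1 - w))
    (h₂ : IsUnit (1 + w)) :
    Ring.inverse (1 - w * w) = Ring.inverse (1 - w) * Ring.inverse (1 + w) := by
  obtain ⟨u, hu⟩ := h₁
  obtain ⟨v, hv⟩ := h₂
  have h : 1 - w * w = ((v * u : Rˣ) : R) := by
    rw [Units.val_mul, hu, hv]; noncomm_ring
  rw [h, ← hu, ← hv, Ring.inverse_unit, Ring.inverse_unit, Ring.inverse_unit, mul_inv_rev,
    Units.val_mul]

theorem two_mul_ringInverse_one_sub_mul {R : Type*} [Ring R] {w : R} (h₁ : IsUnit (1 - w))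
    (h₂ : IsUnit (1 + w)) :
    2 * (Ring.inverse (1 - w) * Ring.inverse (1 + w))
      = Ring.inverse (1 - w) + Ring.inverse (1 + w) := by
  have e₁ := Ring.inverse_mul_cancel _ h₁
  have e₂ := Ring.mul_inverse_cancel _ h₂
  set u := Ring.inverse (1 - w)
  set v := Ring.inverse (1 + w)
  calc 2 * (u * v) = u * ((1 + w) * v) + u * (1 - w) * v := by noncomm_ring
    _ = u + v := by rw [e₁, e₂, mul_one, one_mul]

/-! ### Dyadic resolvent means on the unit circle -/

variable {A : Type*} [NormedRing A] [NormedAlgebra ℂ A]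

/-- The inverse of `1 - exp (i t) a ^ (2 ^ k)`. -/
noncomputable def dyadicResolvent (a : A) (k : ℕ) (t : ℝ) : A :=
  Ring.inverse (1 - Complex.exp (Complex.I * t) • a ^ (2 ^ k))

theorem exp_I_mul_half_sq (t : ℝ) :
    Complex.exp (Complex.I * (t / 2 : ℝ)) * Complex.exp (Complex.I * (t / 2 : ℝ))
      = Complex.exp (Complex.I * t) := by
  rw [← Complex.exp_add]; congr 1; push_cast; ring

theorem exp_I_mul_half_add_pi (t : ℝ) :
    Complex.exp (Complex.I * (t / 2 + Real.pi : ℝ)) = -Complex.exp (Complex.I * (t / 2 : ℝ)) := by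
  rw [Complex.ofReal_add, mul_add, Complex.exp_add, mul_comm Complex.I (Real.pi : ℂ),
    Complex.exp_pi_mul_I, mul_neg_one]

theorem norm_exp_I_mul_sub_le (s t : ℝ) :
    ‖Complex.exp (Complex.I * s) - Complex.exp (Complex.I * t)‖ ≤ |s - t| := by
  have h : Complex.exp (Complex.I * s) - Complex.exp (Complex.I * t)
      = Complex.exp (Complex.I * t) * (Complex.exp (Complex.I * (s - t : ℝ)) - 1) := by
    rw [mul_sub, ← Complex.exp_add, mul_one]
    congr 2; push_cast; ring
  rw [h, norm_mul, Complex.norm_exp_I_mul_ofReal, one_mul]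
  exact Real.norm_exp_I_mul_ofReal_sub_one_le

theorem one_sub_exp_smul_pow_two_pow_succ (a : A) (k : ℕ) (t : ℝ) :
    1 - Complex.exp (Complex.I * t) • a ^ (2 ^ (k + 1))
      = 1 - (Complex.exp (Complex.I * (t / 2 : ℝ)) • a ^ (2 ^ k))
        * (Complex.exp (Complex.I * (t / 2 : ℝ)) • a ^ (2 ^ k)) := by
  rw [smul_mul_smul_comm, exp_I_mul_half_sq, ← pow_add, pow_succ, mul_two]

theorem one_sub_exp_add_pi_smul (a : A) (k : ℕ) (t : ℝ) :
    1 - Complex.exp (Complex.I * (t / 2 + Real.pi : ℝ)) • a ^ (2 ^ k)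
      = 1 + Complex.exp (Complex.I * (t / 2 : ℝ)) • a ^ (2 ^ k) := by
  rw [exp_I_mul_half_add_pi, neg_smul, sub_neg_eq_add]

theorem isUnit_one_sub_exp_smul_pow {a : A} (ha : ∀ z : ℂ, ‖z‖ = 1 → IsUnit (1 - z • a)) (k : ℕ) :
    ∀ t : ℝ, IsUnit (1 - Complex.exp (Complex.I * t) • a ^ (2 ^ k)) := by
  induction k with
  | zero =>
    intro t
    rw [pow_zero, pow_one]
    exact ha _ (Complex.norm_exp_I_mul_ofReal t)
  | succ k ih =>
    intro t
    have h₁ := ih (t / 2)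
    have h₂ := ih (t / 2 + Real.pi)
    rw [one_sub_exp_add_pi_smul] at h₂
    rw [one_sub_exp_smul_pow_two_pow_succ]
    have := h₂.mul h₁
    convert this using 1
    generalize Complex.exp (Complex.I * (t / 2 : ℝ)) • a ^ (2 ^ k) = w
    noncomm_ring

theorem dyadicResolvent_succ_eq_mul {a : A} (ha : ∀ z : ℂ, ‖z‖ = 1 → IsUnit (1 - z • a)) (k : ℕ)
    (t : ℝ) : dyadicResolvent a (k + 1) t
      = dyadicResolvent a k (t / 2) * dyadicResolvent a k (t / 2 + Real.pi) := by
  have h₁ := isUnit_one_sub_exp_smul_pow ha k (t / 2)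
  have h₂ := isUnit_one_sub_exp_smul_pow ha k (t / 2 + Real.pi)
  rw [one_sub_exp_add_pi_smul] at h₂
  rw [dyadicResolvent, dyadicResolvent, dyadicResolvent, one_sub_exp_smul_pow_two_pow_succ,
    one_sub_exp_add_pi_smul, ringInverse_one_sub_mul_self h₁ h₂]

theorem two_smul_dyadicResolvent_succ {a : A} (ha : ∀ z : ℂ, ‖z‖ = 1 → IsUnit (1 - z • a))
    (k : ℕ) (t : ℝ) : (2 : ℂ) • dyadicResolvent a (k + 1) t
      = dyadicResolvent a k (t / 2) + dyadicResolvent a k (t / 2 + Real.pi) := by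
  have h₁ := isUnit_one_sub_exp_smul_pow ha k (t / 2)
  have h₂ := isUnit_one_sub_exp_smul_pow ha k (t / 2 + Real.pi)
  rw [one_sub_exp_add_pi_smul] at h₂
  rw [dyadicResolvent_succ_eq_mul ha, dyadicResolvent, dyadicResolvent, one_sub_exp_add_pi_smul,
    ← two_mul_ringInverse_one_sub_mul h₁ h₂, two_smul, two_mul]

theorem exists_bound_ringInverse_circle [CompleteSpace A] {a : A}
    (ha : ∀ z : ℂ, ‖z‖ = 1 → IsUnit (1 - z • a)) :
    ∃ C : ℝ, ∀ z : ℂ, ‖z‖ = 1 → ‖Ring.inverse (1 - z • a)‖ ≤ C := by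
  have hc : ContinuousOn (fun z : ℂ => Ring.inverse (1 - z • a)) (Metric.sphere 0 1) := by
    intro z hz
    obtain ⟨u, hu⟩ := ha z (by simpa using hz)
    have h₁ : ContinuousAt Ring.inverse (1 - z • a) := hu ▸ NormedRing.inverse_continuousAt u
    have h₂ : ContinuousAt (fun z : ℂ => 1 - z • a) z := by fun_prop
    exact (ContinuousAt.comp (f := fun z : ℂ => 1 - z • a) h₁ h₂).continuousWithinAt
  obtain ⟨C, hC⟩ := (isCompact_sphere (0 : ℂ) 1).exists_bound_of_continuousOn hc
  exact ⟨C, fun z hz => hC z (by simpa using hz)⟩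

/-- The resolvent identity gives the case `k = 0`. Each later level averages two values at half the
angle, which halves the Lipschitz constant. -/
theorem exists_lipschitz_dyadicResolvent [CompleteSpace A] {a : A}
    (ha : ∀ z : ℂ, ‖z‖ = 1 → IsUnit (1 - z • a)) :
    ∃ C : ℝ, 0 ≤ C ∧ ∀ (k : ℕ) (s t : ℝ),
      ‖dyadicResolvent a k s - dyadicResolvent a k t‖ ≤ C * (1 / 2) ^ k * |s - t| := by
  obtain ⟨C, hC⟩ := exists_bound_ringInverse_circle ha
  have hC0 : 0 ≤ C := (norm_nonneg _).trans (hC 1 (by simp))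
  refine ⟨C * ‖a‖ * C, by positivity, fun k => ?_⟩
  induction k with
  | zero =>
    intro s t
    rw [dyadicResolvent, dyadicResolvent, pow_zero, pow_one, pow_zero, mul_one]
    set w := Complex.exp (Complex.I * s) with hw
    set z := Complex.exp (Complex.I * t) with hz
    have nw : ‖w‖ = 1 := Complex.norm_exp_I_mul_ofReal s
    have nz : ‖z‖ = 1 := Complex.norm_exp_I_mul_ofReal t
    have e₁ := Ring.inverse_mul_cancel _ (ha w nw)
    have e₂ := Ring.mul_inverse_cancel _ (ha z nz)
    have bu := hC w nw
    have bv := hC z nz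
    set u := Ring.inverse (1 - w • a)
    set v := Ring.inverse (1 - z • a)
    have h : u - v = u * ((w - z) • a) * v := by
      calc u - v = u * ((1 - z • a) * v) - u * (1 - w • a) * v := by rw [e₁, e₂, mul_one, one_mul]
        _ = u * ((1 - z • a) - (1 - w • a)) * v := by noncomm_ring
        _ = _ := by rw [sub_smul]; congr 2; abel
    rw [h]
    calc ‖u * ((w - z) • a) * v‖ ≤ ‖u‖ * (‖w - z‖ * ‖a‖) * ‖v‖ := by
          refine (norm_mul_le _ _).trans ?_
          gcongr
          refine (norm_mul_le _ _).trans ?_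
          rw [norm_smul]
      _ ≤ C * (|s - t| * ‖a‖) * C := by
          gcongr
          exact norm_exp_I_mul_sub_le s t
      _ = C * ‖a‖ * C * |s - t| := by ring
  | succ k ih =>
    intro s t
    have h₁ := ih (s / 2) (t / 2)
    have h₂ := ih (s / 2 + Real.pi) (t / 2 + Real.pi)
    have e : (2 : ℂ) • (dyadicResolvent a (k + 1) s - dyadicResolvent a (k + 1) t)
        = (dyadicResolvent a k (s / 2) - dyadicResolvent a k (t / 2))
          + (dyadicResolvent a k (s / 2 + Real.pi) - dyadicResolvent a k (t / 2 + Real.pi)) := by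
      rw [smul_sub, two_smul_dyadicResolvent_succ ha, two_smul_dyadicResolvent_succ ha]; abel
    have hn := congrArg norm e
    rw [norm_smul, Complex.norm_ofNat] at hn
    have h₃ := norm_add_le (dyadicResolvent a k (s / 2) - dyadicResolvent a k (t / 2))
      (dyadicResolvent a k (s / 2 + Real.pi) - dyadicResolvent a k (t / 2 + Real.pi))
    rw [add_sub_add_right_eq_sub] at h₂
    have h₄ : |s / 2 - t / 2| = |s - t| / 2 := by
      rw [← sub_div, abs_div, abs_two]
    rw [h₄] at h₁ h₂
    rw [pow_succ]
    linarith

/-- Successive terms differ by half the gap between the values at angles 0 and π, which decays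
geometrically. Both values thus tend to `p`, while their product is the next term, so `p * p = p`.
-/
theorem exists_tendsto_ringInverse_one_sub_pow [CompleteSpace A] {a : A}
    (ha : ∀ z : ℂ, ‖z‖ = 1 → IsUnit (1 - z • a)) :
    ∃ p : A, p * p = p ∧ Commute a p ∧
      Tendsto (fun k : ℕ => Ring.inverse (1 - a ^ (2 ^ k))) atTop (𝓝 p) := by
  obtain ⟨C, hC0, hC⟩ := exists_lipschitz_dyadicResolvent ha
  have h0 : ∀ k, dyadicResolvent a k 0 = Ring.inverse (1 - a ^ (2 ^ k)) := fun k => by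
    simp [dyadicResolvent]
  have hdiff : ∀ k, ‖dyadicResolvent a k 0 - dyadicResolvent a k Real.pi‖
      ≤ C * Real.pi * (1 / 2) ^ k := fun k => by
    have := hC k 0 Real.pi
    rw [zero_sub, abs_neg, abs_of_pos Real.pi_pos] at this
    linarith
  have hstep : ∀ k, dist (dyadicResolvent a k 0) (dyadicResolvent a (k + 1) 0)
      ≤ C * Real.pi * (1 / 2) ^ k := fun k => by
    have e := two_smul_dyadicResolvent_succ ha k 0
    rw [zero_div, zero_add] at e
    have e' : (2 : ℂ) • (dyadicResolvent a k 0 - dyadicResolvent a (k + 1) 0)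
        = dyadicResolvent a k 0 - dyadicResolvent a k Real.pi := by
      rw [smul_sub, e, two_smul]; abel
    have hn := congrArg norm e'
    rw [norm_smul, Complex.norm_ofNat] at hn
    rw [dist_eq_norm]
    linarith [hdiff k, norm_nonneg (dyadicResolvent a k 0 - dyadicResolvent a (k + 1) 0)]
  obtain ⟨p, hp⟩ := cauchySeq_tendsto_of_complete
    (cauchySeq_of_le_geometric (1 / 2) (C * Real.pi) (by norm_num) hstep)
  have hgeom : Tendsto (fun k : ℕ => C * Real.pi * (1 / 2 : ℝ) ^ k) atTop (𝓝 0) := by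
    simpa using (tendsto_pow_atTop_nhds_zero_of_lt_one (by norm_num) (by norm_num :
      (1 / 2 : ℝ) < 1)).const_mul (C * Real.pi)
  have hz : Tendsto (fun k => dyadicResolvent a k 0 - dyadicResolvent a k Real.pi) atTop (𝓝 0) :=
    squeeze_zero_norm hdiff hgeom
  have hpi : Tendsto (fun k => dyadicResolvent a k Real.pi) atTop (𝓝 p) := by
    simpa using hp.sub hz
  have hmul : Tendsto (fun k => dyadicResolvent a (k + 1) 0) atTop (𝓝 (p * p)) := by
    refine (hp.mul hpi).congr fun k => ?_
    rw [dyadicResolvent_succ_eq_mul ha, zero_div, zero_add]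
  refine ⟨p, tendsto_nhds_unique hmul (hp.comp (tendsto_add_atTop_nat 1)), ?_, hp.congr h0⟩
  refine tendsto_nhds_unique (hp.const_mul a) ((hp.mul_const a).congr fun k => ?_)
  rw [h0]
  exact (commute_ringInverse
    ((Commute.one_right a).sub_right ((Commute.refl a).pow_right _))).eq.symm

/-! ### Riesz idempotents -/

theorem exists_riesz_idempotent_unit_circle [CompleteSpace A] {a : A}
    (ha : ∀ z : ℂ, ‖z‖ = 1 → IsUnit (1 - z • a)) :
    ∃ p x : A, p * p = p ∧ Commute a p ∧ Commute a x ∧ a * x = 1 - p ∧ x * a * x = x ∧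
      ∀ μ : ℂ, 1 ≤ ‖μ‖ → IsUnit (a * p - μ • (1 : A)) := by
  obtain ⟨p, hpp, hap, hlim⟩ := exists_tendsto_ringInverse_one_sub_pow ha
  have hu : ∀ k : ℕ, IsUnit (1 - a ^ (2 ^ k)) := fun k => by
    simpa using isUnit_one_sub_exp_smul_pow ha k 0
  have hcomm : ∀ {b : A}, Commute b a → ∀ k : ℕ, Commute b (Ring.inverse (1 - a ^ (2 ^ k))) :=
    fun hb k => commute_ringInverse ((Commute.one_right _).sub_right (hb.pow_right _))
  have hmul : ∀ k : ℕ, a ^ (2 ^ k) * Ring.inverse (1 - a ^ (2 ^ k))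
      = Ring.inverse (1 - a ^ (2 ^ k)) - 1 := fun k => by
    have := Ring.mul_inverse_cancel _ (hu k)
    rw [sub_mul, one_mul] at this
    exact eq_sub_of_add_eq (sub_eq_iff_eq_add'.1 this).symm
  have hpc : p * (1 - p) = 0 := by rw [mul_sub, mul_one, hpp, sub_self]
  have hcp : (1 - p) * p = 0 := by rw [sub_mul, one_mul, hpp, sub_self]
  have hcc : (1 - p) * (1 - p) = 1 - p := by rw [mul_sub, hcp, mul_one, sub_zero]
  have hinv1 : ContinuousAt Ring.inverse (1 : A) := NormedRing.inverse_continuousAt (1 : Aˣ)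
  have hinv {f : ℕ → A} (hf : Tendsto f atTop (𝓝 1)) :
      Tendsto (fun k => Ring.inverse (f k)) atTop (𝓝 1) := by
    simpa [Function.comp_def] using hinv1.tendsto.comp hf
  have hev {f : ℕ → A} (hf : Tendsto f atTop (𝓝 1)) : ∀ᶠ k in atTop, IsUnit (f k) :=
    hf.eventually (Units.isOpen.mem_nhds (isUnit_one : IsUnit (1 : A)))
  have hpow : Tendsto (fun k : ℕ => a ^ (2 ^ k) * p) atTop (𝓝 0) := by
    -- Adding `1 - p` makes the limit 1, so `w k` is eventually invertible and can be divided out.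
    set w : ℕ → A := fun k => Ring.inverse (1 - a ^ (2 ^ k)) * p + (1 - p) with hw
    have hw1 : Tendsto w atTop (𝓝 1) := by
      have := (hlim.mul_const p).add_const (1 - p)
      rwa [hpp, add_sub_cancel] at this
    have h0 : Tendsto (fun k : ℕ => (Ring.inverse (1 - a ^ (2 ^ k)) - 1) * p * Ring.inverse (w k))
        atTop (𝓝 0) := by
      have := ((hlim.sub_const 1).mul_const p).mul (hinv hw1)
      rwa [sub_mul, hpp, one_mul, sub_self, zero_mul] at this
    refine h0.congr' ?_
    filter_upwards [hev hw1] with k hk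
    have hq := (hcomm hap.symm k).eq
    have : a ^ (2 ^ k) * p * w k = (Ring.inverse (1 - a ^ (2 ^ k)) - 1) * p := by
      rw [hw, ← hmul k]
      simp only
      rw [mul_add, mul_assoc _ p (1 - p), hpc, mul_zero, add_zero, ← hq, mul_assoc,
        ← mul_assoc p p, hpp, hq, ← mul_assoc]
    rw [← this, mul_assoc, Ring.mul_inverse_cancel _ hk, mul_one]
  obtain ⟨x₀, hx₀, hax₀⟩ : ∃ x₀ : A, Commute a x₀ ∧ a * x₀ = 1 - p := by
    -- Also tends to 1; on the range of `1 - p` it is a multiple of `a`, so one invertible `v k`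
    -- yields an inverse of `a` there.
    set v : ℕ → A := fun k => p + (1 - p) * (1 - Ring.inverse (1 - a ^ (2 ^ k))) with hv
    have hv1 : Tendsto v atTop (𝓝 1) := by
      have := ((hlim.const_sub 1).const_mul (1 - p)).const_add p
      rwa [hcc, add_sub_cancel] at this
    obtain ⟨k, hk⟩ := (hev hv1).exists
    have hap' : Commute a (1 - p) := (Commute.one_right a).sub_right hap
    have haq := hcomm (Commute.refl a) k
    refine ⟨-(a ^ (2 ^ k - 1) * Ring.inverse (1 - a ^ (2 ^ k)) * (1 - p) * Ring.inverse (v k)),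
      ?_, ?_⟩
    · refine (((((Commute.refl a).pow_right _).mul_right haq).mul_right hap').mul_right
        (commute_ringInverse ?_)).neg_right
      exact hap.add_right (hap'.mul_right ((Commute.one_right a).sub_right haq))
    · have hpk : a * a ^ (2 ^ k - 1) = a ^ (2 ^ k) := by
        rw [← pow_succ', Nat.sub_add_cancel Nat.one_le_two_pow]
      have hq : Commute (1 - p) (Ring.inverse (1 - a ^ (2 ^ k))) := hcomm hap'.symm k
      have hvk : (1 - p) * v k = -(a ^ (2 ^ k) * Ring.inverse (1 - a ^ (2 ^ k)) * (1 - p)) := by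
        rw [hmul k, hv]
        simp only
        rw [mul_add, hcp, zero_add, ← mul_assoc, hcc,
          ((Commute.one_right (1 - p)).sub_right hq).eq, ← neg_mul, neg_sub]
      calc a * -(a ^ (2 ^ k - 1) * Ring.inverse (1 - a ^ (2 ^ k)) * (1 - p) * Ring.inverse (v k))
          = -(a * a ^ (2 ^ k - 1) * Ring.inverse (1 - a ^ (2 ^ k)) * (1 - p))
              * Ring.inverse (v k) := by noncomm_ring
        _ = (1 - p) * v k * Ring.inverse (v k) := by rw [hpk, hvk]
        _ = 1 - p := by rw [mul_assoc, Ring.mul_inverse_cancel _ hk, mul_one]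
  have hx₀a : x₀ * a = 1 - p := hx₀.eq ▸ hax₀
  have hap' : Commute a (1 - p) := (Commute.one_right a).sub_right hap
  refine ⟨p, x₀ * (1 - p), hpp, hap, hx₀.mul_right hap', ?_, ?_, fun μ hμ => ?_⟩
  · rw [← mul_assoc, hax₀, hcc]
  · calc x₀ * (1 - p) * a * (x₀ * (1 - p)) = x₀ * (1 - p) * (a * x₀) * (1 - p) := by
          simp only [mul_assoc]
      _ = x₀ * ((1 - p) * (1 - p) * (1 - p)) := by rw [hax₀]; simp only [mul_assoc]
      _ = x₀ * (1 - p) := by rw [hcc, hcc]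
  · have hμ0 : μ ≠ 0 := by
      rintro rfl
      simp at hμ
      linarith
    obtain ⟨k, hk⟩ := (hpow.norm.eventually (gt_mem_nhds (by simp : ‖(0 : A)‖ < 1))).exists
    have hpk : (a * p) ^ (2 ^ k) = a ^ (2 ^ k) * p := by
      rw [hap.mul_pow, IsIdempotentElem.pow_eq (show IsIdempotentElem p from hpp) (by positivity)]
    have hlt : ‖(μ⁻¹ • (a * p)) ^ (2 ^ k)‖ < 1 := by
      rw [smul_pow, hpk, norm_smul, norm_pow, norm_inv]
      refine (mul_le_of_le_one_left (norm_nonneg _) ?_).trans_lt hk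
      exact pow_le_one₀ (by positivity) (inv_le_one_of_one_le₀ hμ)
    -- `1 - b` is a commuting factor of the unit `1 - b ^ (2 ^ k)`.
    have h1 : IsUnit (1 - μ⁻¹ • (a * p)) := by
      have := isUnit_one_sub_of_norm_lt_one hlt
      rw [← mul_neg_geom_sum] at this
      refine (Commute.isUnit_mul_iff ?_).1 this |>.1
      refine ((Commute.one_left _).sub_left ?_)
      exact Commute.sum_right _ _ _ fun i _ => (Commute.refl _).pow_right i
    have h2 : a * p - μ • (1 : A) = (Units.mk0 (-μ) (neg_ne_zero.2 hμ0)) • (1 - μ⁻¹ • (a * p)) := by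
      rw [Units.smul_mk0, smul_sub, smul_smul, neg_mul, mul_inv_cancel₀ hμ0]
      simp only [neg_smul, one_smul]
      abel
    rw [h2]
    exact h1.smul _

theorem exists_riesz_idempotent_circle [CompleteSpace A] {a : A} {r : ℝ} (hr : 0 < r)
    (ha : ∀ z : ℂ, ‖z‖ = r → IsUnit (a - z • (1 : A))) :
    ∃ p x : A, p * p = p ∧ Commute a p ∧ Commute a x ∧ a * x = 1 - p ∧ x * a * x = x ∧
      ∀ μ : ℂ, r ≤ ‖μ‖ → IsUnit (a * p - μ • (1 : A)) := by
  have hr0 : (r : ℂ) ≠ 0 := by exact_mod_cast hr.ne'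
  have nr : ‖(r : ℂ)‖ = r := by simp [abs_of_pos hr]
  obtain ⟨p, x, hpp, hap, hax, h₁, h₂, h₃⟩ :=
      exists_riesz_idempotent_unit_circle (a := (r : ℂ)⁻¹ • a) fun z hz => by
    have hz0 : z ≠ 0 := by rintro rfl; simp at hz
    have h := ha (r * z⁻¹) (by rw [norm_mul, nr, norm_inv, hz]; simp)
    have e : 1 - z • (r : ℂ)⁻¹ • a
        = Units.mk0 (-(z * (r : ℂ)⁻¹)) (neg_ne_zero.2 (mul_ne_zero hz0 (inv_ne_zero hr0)))
          • (a - (r * z⁻¹) • (1 : A)) := by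
      rw [Units.smul_mk0, smul_sub, smul_smul, smul_smul]
      have : -(z * (r : ℂ)⁻¹) * (r * z⁻¹) = -1 := by field_simp
      rw [this]
      simp only [neg_smul, one_smul]
      abel
    rw [e]
    exact h.smul _
  have hap : Commute a p := by
    simpa [smul_smul, hr0] using hap.smul_left (r : ℂ)
  have hax : Commute a x := by
    simpa [smul_smul, hr0] using hax.smul_left (r : ℂ)
  refine ⟨p, (r : ℂ)⁻¹ • x, hpp, hap, hax.smul_right _, ?_, ?_, fun μ hμ => ?_⟩
  · rw [mul_smul_comm, ← smul_mul_assoc, h₁]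
  · rw [mul_smul_comm, smul_mul_assoc, smul_mul_assoc]
    congr 1
    rwa [mul_smul_comm, smul_mul_assoc] at h₂
  · have h := h₃ ((r : ℂ)⁻¹ * μ) (by
      rw [norm_mul, norm_inv, nr, inv_mul_eq_div]
      exact (one_le_div hr).2 hμ)
    have e : a * p - μ • (1 : A)
        = Units.mk0 (r : ℂ) hr0 • ((r : ℂ)⁻¹ • a * p - ((r : ℂ)⁻¹ * μ) • (1 : A)) := by
      rw [Units.smul_mk0, smul_sub, smul_mul_assoc, smul_smul, smul_smul, mul_inv_cancel_left₀ hr0,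
        mul_inv_cancel₀ hr0, one_smul]
    rw [e]
    exact h.smul _

/-! ### Comparing the spectra of `a` and `a * p` -/

theorem mem_spectrum_iff_not_isUnit_sub_smul {a : A} {μ : ℂ} :
    μ ∈ spectrum ℂ a ↔ ¬ IsUnit (a - μ • (1 : A)) := by
  rw [spectrum.mem_iff, IsUnit.sub_iff, Algebra.algebraMap_eq_smul_one]

theorem isUnit_of_commute_of_mul_eq_one {R : Type*} [Monoid R] {b y : R} (hc : Commute b y)
    (h : b * y = 1) : IsUnit b :=
  ⟨⟨b, y, h, hc.eq ▸ h⟩, rfl⟩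

/-- `a * p - μ` acts as `a - μ` on the range of `p` and as `-μ` on that of `1 - p`; the two inverses
are glued. -/
theorem isUnit_mul_idempotent_sub_smul {a p : A} (hpp : p * p = p) (hap : Commute a p) {μ : ℂ}
    (hμ : μ ≠ 0) (h : IsUnit (a - μ • (1 : A))) : IsUnit (a * p - μ • (1 : A)) := by
  set s := a - μ • (1 : A) with hs
  have hsp : Commute s p := hap.sub_left ((Commute.one_left p).smul_left μ)
  set u := Ring.inverse s
  have hsu : s * u = 1 := Ring.mul_inverse_cancel _ h
  have hpu : Commute p u := commute_ringInverse hsp.symm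
  have hcp : (1 - p) * p = 0 := by rw [sub_mul, one_mul, hpp, sub_self]
  have hpc : p * (1 - p) = 0 := by rw [mul_sub, mul_one, hpp, sub_self]
  have hcc : (1 - p) * (1 - p) = 1 - p := by rw [mul_sub, hcp, mul_one, sub_zero]
  have e : a * p - μ • (1 : A) = s * p - μ • (1 - p) := by
    rw [hs, sub_mul, smul_mul_assoc, one_mul, smul_sub]; abel
  have hsu' : Commute s u := commute_ringInverse (Commute.refl s)
  have hc1 : ∀ {b : A}, Commute b p → Commute b (1 - p) := fun hb =>
    (Commute.one_right _).sub_right hb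
  rw [e]
  refine isUnit_of_commute_of_mul_eq_one (y := u * p - μ⁻¹ • (1 - p)) ?_ ?_
  · have h₁ : Commute (s * p) (u * p - μ⁻¹ • (1 - p)) :=
      ((hsu'.mul_left hpu).mul_right (hsp.mul_left (Commute.refl p))).sub_right
        ((hc1 (hsp.mul_left (Commute.refl p))).smul_right _)
    have h₂ : Commute (1 - p) (u * p - μ⁻¹ • (1 - p)) :=
      ((hc1 hpu.symm).symm.mul_right (hc1 (Commute.refl p)).symm).sub_right
        ((Commute.refl _).smul_right _)
    exact h₁.sub_left (h₂.smul_left μ)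
  · have t₁ : s * p * (u * p) = p := by
      rw [hsp.eq, mul_assoc, ← mul_assoc s, hsu, one_mul, hpp]
    have t₂ : s * p * (1 - p) = 0 := by rw [mul_assoc, hpc, mul_zero]
    have t₃ : (1 - p) * (u * p) = 0 := by rw [← hpu.eq, ← mul_assoc, hcp, zero_mul]
    rw [sub_mul (s * p), mul_sub (s * p), mul_sub (μ • (1 - p)), mul_smul_comm μ⁻¹ (s * p),
      smul_mul_smul_comm, smul_mul_assoc, t₁, t₂, t₃, hcc, mul_inv_cancel₀ hμ, one_smul, smul_zero,
      smul_zero]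
    abel

/-- On the range of `1 - p`, `x` inverts `a`, so `a - μ` has inverse `x (1 - μ x)⁻¹` there. -/
theorem isUnit_sub_smul_of_isUnit_mul_idempotent {a x p : A} (hax : Commute a x)
    (hxax : x * a * x = x) (hp : a * x = 1 - p) {μ : ℂ} (h₁ : IsUnit (1 - μ • x))
    (h₂ : IsUnit (a * p - μ • (1 : A))) : IsUnit (a - μ • (1 : A)) := by
  have hp' : p = 1 - a * x := by rw [hp]; abel
  have hpx : p * x = 0 := by rw [hp', sub_mul, one_mul, hax.eq, hxax, sub_self]
  have hap : Commute a p := hp' ▸ (Commute.one_right a).sub_right ((Commute.refl a).mul_right hax)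
  have hpp : p * p = p := by
    nth_rw 2 [hp']
    rw [mul_sub, mul_one, hax.eq, ← mul_assoc, hpx, zero_mul, sub_zero]
  set u := Ring.inverse (a * p - μ • (1 : A))
  set v := Ring.inverse (1 - μ • x)
  set s := a - μ • (1 : A) with hs
  have hsp : s * p = p * (a * p - μ • (1 : A)) := by
    rw [hs, sub_mul, mul_sub, ← mul_assoc, ← hap.eq, mul_assoc, hpp, smul_mul_assoc, one_mul,
      mul_smul_comm, mul_one]
  have hsx : s * x = (1 - p) * (1 - μ • x) := by
    rw [hs, sub_mul, hp, smul_mul_assoc, one_mul, sub_mul, one_mul, mul_sub, mul_one,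
      mul_smul_comm, hpx, smul_zero]
    abel
  have hsc : ∀ {b : A}, Commute a b → Commute s b := fun hb =>
    hb.sub_left ((Commute.one_left _).smul_left μ)
  refine isUnit_of_commute_of_mul_eq_one (y := p * u + x * v) ?_ ?_
  · have h₃ : Commute s u := commute_ringInverse
      (((hsc (Commute.refl a)).mul_right (hsc hap)).sub_right
        ((Commute.one_right _).smul_right μ))
    have h₄ : Commute s v := commute_ringInverse
      ((Commute.one_right _).sub_right ((hsc hax).smul_right μ))
    exact ((hsc hap).mul_right h₃).add_right ((hsc hax).mul_right h₄)
  · rw [mul_add, ← mul_assoc, hsp, ← mul_assoc, hsx, mul_assoc, mul_assoc (1 - p),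
      Ring.mul_inverse_cancel _ h₂, Ring.mul_inverse_cancel _ h₁,
      mul_one, mul_one, add_sub_cancel]

/-! ### Accumulation points and the Drazin spectra -/

theorem mem_derivedSet_of_eventually {X : Type*} [TopologicalSpace X] {x : X} {S T : Set X}
    (h : ∀ᶠ y in 𝓝 x, y ≠ x → y ∈ S → y ∈ T) (hx : x ∈ derivedSet S) : x ∈ derivedSet T := by
  rw [mem_derivedSet, accPt_iff_frequently] at hx ⊢
  exact (hx.and_eventually h).mono fun y hy => ⟨hy.1.1, hy.2 hy.1.1 hy.1.2⟩

theorem not_mem_derivedSet_iff {X : Type*} [TopologicalSpace X] {x : X} {S : Set X} :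
    x ∉ derivedSet S ↔ ∀ᶠ y in 𝓝 x, y ≠ x → y ∉ S := by
  rw [mem_derivedSet, accPt_iff_frequently, not_frequently]
  simp only [not_and]

theorem zero_mem_derivedSet_iff_of_translate {S T : Set ℂ} {μ : ℂ}
    (h : ∀ z, z ∈ T ↔ z + μ ∈ S) : 0 ∈ derivedSet T ↔ μ ∈ derivedSet S := by
  rw [mem_derivedSet, mem_derivedSet, accPt_iff_frequently, accPt_iff_frequently]
  nth_rw 2 [← zero_add μ]
  rw [← map_add_right_nhds, frequently_map]
  simp [h]

theorem sub_sq_mul_eq {R : Type*} [Ring R] {a x p : R} (hp : a * x = 1 - p) : a - a ^ 2 * x = a * p := by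
  rw [pow_two, mul_assoc, hp, mul_sub, mul_one, sub_sub_cancel]

theorem eventually_isUnit_one_sub_smul [CompleteSpace A] (x : A) :
    ∀ᶠ μ : ℂ in 𝓝 0, IsUnit (1 - μ • x) := by
  have hc : Continuous fun μ : ℂ => 1 - μ • x := by fun_prop
  exact (hc.tendsto 0).eventually (Units.isOpen.mem_nhds (by simp : IsUnit (1 - (0 : ℂ) • x)))

/-- The inner neighbourhood lets accumulation points, not just spectral points, pass to `a * p`. -/
theorem eventually_mem_spectrum_mul_idempotent [CompleteSpace A] {a x p : A} (hax : Commute a x)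
    (hxax : x * a * x = x) (hp : a * x = 1 - p) :
    ∀ᶠ μ : ℂ in 𝓝 0, ∀ᶠ ν in 𝓝 μ, ν ∈ spectrum ℂ a → ν ∈ spectrum ℂ (a * p) := by
  refine (eventually_isUnit_one_sub_smul x).eventually_nhds.mono fun μ hμ => hμ.mono fun ν hν => ?_
  rw [mem_spectrum_iff_not_isUnit_sub_smul, mem_spectrum_iff_not_isUnit_sub_smul]
  exact mt (isUnit_sub_smul_of_isUnit_mul_idempotent hax hxax hp hν)

/-- Koliha's characterization of generalized Drazin invertibility. -/
theorem isGDrazinInvertible_iff [CompleteSpace A] [Nontrivial A] {a : A} :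
    IsGDrazinInvertible a ↔ (0 : ℂ) ∉ derivedSet (spectrum ℂ a) := by
  rw [not_mem_derivedSet_iff]
  constructor
  · rintro ⟨x, hax, hxax, hq⟩
    have hp : a * x = 1 - (1 - a * x) := by abel
    rw [sub_sq_mul_eq hp, IsQuasinilpotent] at hq
    filter_upwards [eventually_mem_spectrum_mul_idempotent hax hxax hp] with μ hμ hμ0 hμa
    have := hμ.self_of_nhds hμa
    rw [hq] at this
    exact hμ0 this
  · intro h
    obtain ⟨ε, hε, hball⟩ := Metric.eventually_nhds_iff.1 h
    have hun : ∀ μ : ℂ, μ ≠ 0 → ‖μ‖ < ε → IsUnit (a - μ • (1 : A)) := fun μ h₀ h₁ => by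
      have := hball (by simpa using h₁) h₀
      rwa [mem_spectrum_iff_not_isUnit_sub_smul, not_not] at this
    obtain ⟨p, x, hpp, hap, hax, hp, hxax, hbig⟩ :=
        exists_riesz_idempotent_circle (a := a) (half_pos hε) fun z hz =>
      hun z (by rintro rfl; simp at hz; linarith) (by linarith)
    refine ⟨x, hax, hxax, ?_⟩
    rw [sub_sq_mul_eq hp]
    refine (spectrum.nonempty (a * p)).subset_singleton_iff.1 fun μ hμ => ?_
    rw [mem_spectrum_iff_not_isUnit_sub_smul] at hμ
    by_contra hμ0
    refine hμ ?_
    rcases lt_or_ge ‖μ‖ (ε / 2) with h₁ | h₁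
    · exact isUnit_mul_idempotent_sub_smul hpp hap hμ0 (hun μ hμ0 (by linarith))
    · exact hbig μ h₁

theorem gDrazinSpectrum_eq_derivedSet_spectrum [CompleteSpace A] [Nontrivial A] (a : A) :
    gDrazinSpectrum a = derivedSet (spectrum ℂ a) := by
  ext μ
  rw [gDrazinSpectrum, Set.mem_ofPred_eq, isGDrazinInvertible_iff, not_not]
  refine zero_mem_derivedSet_iff_of_translate fun z => ?_
  rw [mem_spectrum_iff_not_isUnit_sub_smul, mem_spectrum_iff_not_isUnit_sub_smul, add_smul,
    sub_sub, add_comm]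

theorem memAcc_iff [CompleteSpace A] [Nontrivial A] {a : A} :
    MemAcc a ↔ ∀ μ : ℂ, μ ≠ 0 → μ ∉ derivedSet (spectrum ℂ a) := by
  refine forall₂_congr fun μ _ => ?_
  rw [← gDrazinSpectrum_eq_derivedSet_spectrum, gDrazinSpectrum, Set.mem_ofPred_eq, not_not]

/-- By compactness a closed annulus inside the punctured disc meets `S` in a finite set, so some
radius is missed. -/
theorem exists_sphere_disjoint {S : Set ℂ} (hS : IsClosed S) {ε : ℝ} (hε : 0 < ε)
    (h : ∀ μ : ℂ, ‖μ‖ < ε → μ ≠ 0 → μ ∉ derivedSet S) :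
    ∃ r, 0 < r ∧ r < ε ∧ ∀ z : ℂ, ‖z‖ = r → z ∉ S := by
  set K : Set ℂ := {z | ε / 3 ≤ ‖z‖ ∧ ‖z‖ ≤ ε / 2} ∩ S with hK
  have hKc : IsCompact K := by
    refine (isCompact_closedBall (0 : ℂ) (ε / 2)).of_isClosed_subset
      (((isClosed_le continuous_const continuous_norm).inter
        (isClosed_le continuous_norm continuous_const)).inter hS) fun z hz => ?_
    simpa using hz.1.2
  have hfin : K.Finite := by
    by_contra hinf
    obtain ⟨z, hzK, hz⟩ := Set.Infinite.exists_accPt_of_subset_isCompact hinf hKc subset_rfl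
    refine h z (by linarith [hzK.1.2]) ?_ (derivedSet_mono _ _ Set.inter_subset_right hz)
    rintro rfl
    have := hzK.1.1
    rw [norm_zero] at this
    linarith
  obtain ⟨r, hr, hrK⟩ := (Set.Icc_infinite (by linarith : ε / 3 < ε / 2)).exists_notMem_finite
    (hfin.image norm)
  refine ⟨r, by linarith [hr.1], by linarith [hr.2], fun z hz hzS => hrK ⟨z, ⟨?_, hzS⟩, hz⟩⟩
  rw [Set.mem_ofPred_eq, hz]
  exact hr

theorem isAGDrazinInvertible_iff_of_nontrivial [CompleteSpace A] [Nontrivial A] {a : A} :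
    IsAGDrazinInvertible a ↔ (0 : ℂ) ∉ derivedSet (gDrazinSpectrum a) := by
  rw [gDrazinSpectrum_eq_derivedSet_spectrum, not_mem_derivedSet_iff]
  constructor
  · rintro ⟨x, hax, hxax, hq⟩
    have hp : a * x = 1 - (1 - a * x) := by abel
    rw [sub_sq_mul_eq hp, memAcc_iff] at hq
    filter_upwards [eventually_mem_spectrum_mul_idempotent hax hxax hp] with μ hμ hμ0 hμa
    exact hq μ hμ0 (mem_derivedSet_of_eventually (hμ.mono fun _ h _ => h) hμa)
  · intro h
    obtain ⟨ε, hε, hball⟩ := Metric.eventually_nhds_iff.1 h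
    have hball : ∀ μ : ℂ, ‖μ‖ < ε → μ ≠ 0 → μ ∉ derivedSet (spectrum ℂ a) := fun μ h₀ h₁ =>
      hball (by simpa using h₀) h₁
    obtain ⟨r, hr, hrε, hsph⟩ := exists_sphere_disjoint (spectrum.isClosed a) hε hball
    obtain ⟨p, x, hpp, hap, hax, hp, hxax, hbig⟩ :=
        exists_riesz_idempotent_circle (a := a) hr fun z hz => by
      have := hsph z hz
      rwa [mem_spectrum_iff_not_isUnit_sub_smul, not_not] at this
    refine ⟨x, hax, hxax, ?_⟩
    rw [sub_sq_mul_eq hp, memAcc_iff]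
    intro μ hμ0 hμ
    have hμp : μ ∈ spectrum ℂ (a * p) :=
      (isClosed_iff_derivedSet_subset _).1 (spectrum.isClosed _) hμ
    have hμr : ‖μ‖ < r := by
      by_contra hle
      exact mem_spectrum_iff_not_isUnit_sub_smul.1 hμp (hbig μ (not_lt.1 hle))
    -- Away from 0 the spectrum of `a * p` lies in that of `a`, so `μ` would accumulate the latter
    -- inside the excluded disc.
    refine hball μ (hμr.trans hrε) hμ0 (mem_derivedSet_of_eventually ?_ hμ)
    filter_upwards [isOpen_ne.mem_nhds hμ0] with ν hν _
    rw [mem_spectrum_iff_not_isUnit_sub_smul, mem_spectrum_iff_not_isUnit_sub_smul]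
    exact mt (isUnit_mul_idempotent_sub_smul hpp hap hν)

theorem not_isGDrazinInvertible_of_subsingleton [Subsingleton A] (a : A) :
    ¬ IsGDrazinInvertible a := by
  rintro ⟨x, -, -, hq⟩
  rw [IsQuasinilpotent, spectrum.of_subsingleton] at hq
  exact Set.singleton_ne_empty _ hq.symm

theorem isAGDrazinInvertible_iff [CompleteSpace A] {a : A} :
    IsAGDrazinInvertible a ↔ (0 : ℂ) ∉ derivedSet (gDrazinSpectrum a) := by
  rcases subsingleton_or_nontrivial A with _ | _
  · have hu : gDrazinSpectrum a = Set.univ :=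
      Set.eq_univ_of_forall fun μ => not_isGDrazinInvertible_of_subsingleton _
    -- In the zero algebra spectra are empty, so nothing is quasinilpotent and both sides fail.
    refine iff_of_false ?_ (not_not.2 ?_)
    · rintro ⟨x, -, -, hq⟩
      exact not_isGDrazinInvertible_of_subsingleton _ (hq 1 one_ne_zero)
    · rw [hu]
      exact accPt_iff_frequently_nhdsNE.2 (Eventually.of_forall fun _ => trivial).frequently
  · exact isAGDrazinInvertible_iff_of_nontrivial

end AGDrazin

theorem mainTheorem2 {A : Type*} [NormedRing A] [NormedAlgebra ℂ A] [CompleteSpace A] (a : A) :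
    (AGDrazin.IsAGDrazinInvertible a ↔ (0 : ℂ) ∉ derivedSet (AGDrazin.gDrazinSpectrum a)) ∧
      AGDrazin.agDrazinSpectrum a = derivedSet (AGDrazin.gDrazinSpectrum a) := by
  refine ⟨AGDrazin.isAGDrazinInvertible_iff, ?_⟩
  ext μ
  rw [AGDrazin.agDrazinSpectrum, Set.mem_ofPred_eq, AGDrazin.isAGDrazinInvertible_iff, not_not]
  refine AGDrazin.zero_mem_derivedSet_iff_of_translate fun z => ?_
  rw [AGDrazin.gDrazinSpectrum, Set.mem_ofPred_eq, AGDrazin.gDrazinSpectrum, Set.mem_ofPred_eq,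
    add_smul, sub_sub, add_comm (μ • (1 : A))]
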